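/- Mean-square convergence. Let $\mathbb G$ be a connected undirected graph on the nodes $\{1,\dots,N\}$ with Laplacian matrix $\mathbf L$ and neighbour sets $\mathbb N_n$, let $\mathbf x=(x_1,\dots,x_N)\in\mathbb R^N$, and let $0<p<1$ with $p\notin\{\frac1N,\frac2N,\dots,1\}$. With $u(t)=1$ for $t\ge 0$ and $u(t)=0$ for $t<0$, let $\widehat F(w)=\frac1N\sum_{n=1}^N u(w-x_n)$ be the empirical CDF of the data and $\theta_p=\inf\{w\in\mathbb R:\widehat F(w)\ge p\}$ its $p$-quantile. For every link from $l$ to $n$ (i.e. $l\in\mathbb N_n$) let $\{\xi_{nl}(i)\}_{i\ge0}$ be an i.i.d. sequence of real random variables with mean zero, where $\sup_{n,l,i}E[\xi_{nl}^2(i)]<\infty$. Put $\boldsymbol\xi(i)=-\big[\sum_{l\in\mathbb N_1}\xi_{1l}(i),\dots,\sum_{l\in\mathbb N_N}\xi_{Nl}(i)\big]^T$. Let $$\alpha(i)=\frac{\alpha_0}{(i+1)^{\tau_1}},\qquad \eta(i)=\frac{\eta_0}{(i+1)^{\tau_2}},\qquad i\ge 0,$$ where $\alpha_0,\eta_0>0$,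 $1\ge\tau_1>\tau_2>\frac12$ and $\tau_1-\tau_2<\frac12$. Define $\boldsymbol\omega(0)=\mathbf x$ and $$\boldsymbol\omega(i+1)=\big(\mathbf I-\eta(i)\mathbf L\big)\big(\boldsymbol\omega(i)-\alpha(i)\mathbf y(i)\big)-\eta(i)\boldsymbol\xi(i),\qquad y_n(i)=u\big(\omega_n(i)-x_n\big)-p .$$ Then $E\big[\|\boldsymbol\omega(i)-\theta_p\mathbf 1\|^2\big]$ is finite for every $i$, and $$\lim_{i\to\infty}E\Big[\big\|\boldsymbol\omega(i)-\theta_p\mathbf 1\big\|^2\Big]=0,$$ where $\|\cdot\|$ is the Euclidean norm and $\mathbf 1$ is the all-ones vector. -/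

import Mathlib

open MeasureTheory ProbabilityTheory Filter Topology

noncomputable section

namespace DistQuantile

/-- The unit step function: `u t = 1` if `t ≥ 0`, and `0` otherwise. -/
def unitStep (t : ℝ) : ℝ := if 0 ≤ t then 1 else 0

/-- The empirical CDF of the data `x`, evaluated at `w`. -/
def ecdf {N : ℕ} (x : Fin N → ℝ) (w : ℝ) : ℝ :=
  (1 / (N : ℝ)) * ∑ n, unitStep (w - x n)

/-- The `p`-quantile of the data `x`: the infimum of all `w` whose empirical CDF is at
least `p`. -/
def quantile {N : ℕ} (x : Fin N → ℝ) (p : ℝ) : ℝ :=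
  sInf {w : ℝ | p ≤ ecdf x w}

/-- The polynomially decaying step size `a / (i + 1) ^ τ`. -/
def stepSize (a τ : ℝ) (i : ℕ) : ℝ := a / ((i : ℝ) + 1) ^ τ

/-- The innovation vector at the state `w`: its `n`-th entry is `u (w n - x n) - p`. -/
def innovation {N : ℕ} (x : Fin N → ℝ) (p : ℝ) (w : Fin N → ℝ) : Fin N → ℝ :=
  fun n => unitStep (w n - x n) - p

/-- The noise vector at one time: its `n`-th entry is minus the sum, over the neighbours `l`
of `n`, of the noise `v n l` on the link from `l` to `n`. -/
def noiseVector {N : ℕ} (G : SimpleGraph (Fin N)) [DecidableRel G.Adj]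
    (v : Fin N → Fin N → ℝ) : Fin N → ℝ :=
  fun n => -∑ l ∈ G.neighborFinset n, v n l

/-- The states of the distributed quantile estimation algorithm with step sizes `α`, `η` and
link noises `ξ n l i` (on the link from `l` to `n` at time `i`), at the sample point `s`. -/
def state {N : ℕ} {Ω : Type*} (G : SimpleGraph (Fin N)) [DecidableRel G.Adj]
    (x : Fin N → ℝ) (p : ℝ) (α η : ℕ → ℝ) (ξ : Fin N → Fin N → ℕ → Ω → ℝ) (s : Ω) :
    ℕ → Fin N → ℝ
  | 0 => x
  | i + 1 =>
    (1 - η i • G.lapMatrix ℝ).mulVec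
        (state G x p α η ξ s i - α i • innovation x p (state G x p α η ξ s i))
      - η i • noiseVector G (fun n l => ξ n l i s)

/-- The supremum, over all links of the network and all times, of the second moment of the
link noise, as an extended nonnegative number. -/
def noiseVarianceSup {N : ℕ} {Ω : Type*} [MeasurableSpace Ω] (P : Measure Ω)
    (G : SimpleGraph (Fin N)) (ξ : Fin N → Fin N → ℕ → Ω → ℝ) : ENNReal :=
  ⨆ (n : Fin N) (l : Fin N) (_ : G.Adj n l) (i : ℕ),
    ∫⁻ s, ENNReal.ofReal ((ξ n l i s) ^ 2) ∂P

/-- The squared Euclidean distance of the state vector `w` from the constant vector `θ · 1`. -/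
def sqError {N : ℕ} (w : Fin N → ℝ) (θ : ℝ) : ℝ :=
  ‖(WithLp.toLp 2 (w - θ • (1 : Fin N → ℝ)) : EuclideanSpace ℝ (Fin N))‖ ^ 2

end DistQuantile

end

/-! The proof is pathwise, followed by dominated convergence. Let `h` be the accumulated weighted
noise minus a constant. In the variable `w - h` the noise increments disappear and leave only the
perturbation `-η L h` (`IsPath.sub_succ`). The new recursion splits along the all-ones vector.

The disagreement part contracts by `1 - η λ / 2`, with `λ` the spectral gap, against a forcing of
order `α + η ‖h‖`. Since `α / η → 0` and `∑ η = ∞`, it vanishes when `h → 0`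
(`consensus_tendsto_zero`). The Laplacian is invisible to the average, which moves by minus `α`
times the mean innovation. Once the average is further from the quantile than the disagreement plus
`‖h‖`, all coordinates of `w` lie on one side of the quantile. The mean innovation then has the
correcting sign, and its size is at least some `δ > 0` because `p` is not a multiple of `1 / N`. As
`∑ α = ∞`, the average is driven to the quantile (`IsPath.abs_mean_succ_le`, `IsPath.tendsto`).

On each link the weighted noise is independent, centred and square-summable, so its series converges
almost surely; taking the limit as the constant in `h` gives `h → 0`. For domination the constant is
`0`: the error is at most `C * (1 + sup ‖h‖)` with `C` deterministic (`exists_isPath_bound`), and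
the squared supremum is integrable by Doob's `L²` inequality (`exists_integrable_sum_sq_le`). -/

/-! ### Scalar recursions. -/

/-- A sequence that at each step either decreases by `b i` or falls below the level `M`
eventually stays below `M`, provided that `∑ b i` diverges. -/
theorem eventually_le_of_le_max_sub {r b : ℕ → ℝ} {M : ℝ} (hb : ∀ i, 0 ≤ b i)
    (hdiv : Tendsto (fun n => ∑ i ∈ Finset.range n, b i) atTop atTop)
    (h : ∀ᶠ i in atTop, r (i + 1) ≤ max (r i - b i) M) : ∀ᶠ i in atTop, r i ≤ M := by
  obtain ⟨i₀, hi₀⟩ := eventually_atTop.1 h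
  have key : ∀ i, i₀ ≤ i →
      r i ≤ max (r i₀ + ∑ j ∈ Finset.range i₀, b j - ∑ j ∈ Finset.range i, b j) M := by
    intro i hi
    induction i, hi using Nat.le_induction with
    | base => simp
    | succ k hk ih =>
      rw [Finset.sum_range_succ]
      refine (hi₀ k hk).trans (max_le ?_ (le_max_right _ _))
      rcases le_max_iff.1 ih with h1 | h1
      · exact le_max_of_le_left (by linarith)
      · exact le_max_of_le_right (by linarith [hb k])
  filter_upwards [eventually_ge_atTop i₀,
    hdiv.eventually_ge_atTop (r i₀ + ∑ j ∈ Finset.range i₀, b j - M)] with i hi hs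
  exact (key i hi).trans (max_le (by linarith) le_rfl)

theorem bddAbove_range_of_eventually_le_max {r : ℕ → ℝ} {M : ℝ}
    (h : ∀ᶠ i in atTop, r (i + 1) ≤ max (r i) M) : BddAbove (Set.range r) := by
  obtain ⟨i₀, hi₀⟩ := eventually_atTop.1 h
  have key : ∀ i, i₀ ≤ i → r i ≤ max (r i₀) M := by
    intro i hi
    induction i, hi using Nat.le_induction with
    | base => simp
    | succ k hk ih => exact (hi₀ k hk).trans (max_le ih (le_max_right _ _))
  refine IsBoundedUnder.bddAbove_range ⟨max (r i₀) M, ?_⟩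
  rw [eventually_map]
  exact eventually_atTop.2 ⟨i₀, key⟩

/-- Averaging recursions `r ↦ (1 - a) r + a g` with `g → 0` and `∑ a = ∞` converge to zero. -/
theorem tendsto_zero_of_le_averaging {r a g : ℕ → ℝ} (hr : ∀ i, 0 ≤ r i) (ha : ∀ i, 0 ≤ a i)
    (ha1 : ∀ᶠ i in atTop, a i ≤ 1)
    (hdiv : Tendsto (fun n => ∑ i ∈ Finset.range n, a i) atTop atTop)
    (hg : Tendsto g atTop (𝓝 0))
    (h : ∀ᶠ i in atTop, r (i + 1) ≤ (1 - a i) * r i + a i * g i) :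
    Tendsto r atTop (𝓝 0) := by
  rw [tendsto_order]
  refine ⟨fun b hb => Eventually.of_forall fun i => hb.trans_le (hr i), fun b hb => ?_⟩
  have hε : 0 < b / 4 := by linarith
  -- Once `g ≤ b / 4`, each step taken from `r ≥ b / 2` loses at least `a * (b / 4)`.
  have hev : ∀ᶠ i in atTop, r i ≤ b / 2 := by
    refine eventually_le_of_le_max_sub (b := fun i => a i * (b / 4))
      (fun i => mul_nonneg (ha i) hε.le) ?_ ?_
    · simp_rw [← Finset.sum_mul]
      exact hdiv.atTop_mul_const hε
    · filter_upwards [h, ha1, hg.eventually_le_const hε] with i hi hi1 hgi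
      have h1 : a i * g i ≤ a i * (b / 4) := mul_le_mul_of_nonneg_left hgi (ha i)
      rcases le_total (r i) (b / 2) with h2 | h2
      · refine le_max_of_le_right ?_
        nlinarith [mul_le_mul_of_nonneg_left h2 (sub_nonneg.2 hi1), ha i]
      · refine le_max_of_le_left ?_
        nlinarith [mul_le_mul_of_nonneg_left h2 (ha i)]
  filter_upwards [hev] with i hi
  linarith

/-! ### Contraction of the disagreement in an abstract inner product space. -/

section Consensus

variable {E : Type*} [NormedAddCommGroup E] [InnerProductSpace ℝ E]

/-- Expand the square: coercivity gives `-2ηλ‖q‖²`, and for small `η` the term `η²‖T q‖²` costs at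
most `ηλ‖q‖²`. What remains is `1 - ηλ ≤ (1 - ηλ/2)²`. -/
theorem norm_sub_smul_le_of_coercive (T : E →L[ℝ] E) {lam η : ℝ} {q : E}
    (hcoer : lam * ‖q‖ ^ 2 ≤ inner ℝ q (T q)) (hη : 0 ≤ η) (hηT : η * ‖T‖ ^ 2 ≤ lam)
    (hη1 : η * lam ≤ 1) : ‖q - η • T q‖ ≤ (1 - η * lam / 2) * ‖q‖ := by
  refine abs_le_of_sq_le_sq' ?_ (mul_nonneg (by linarith) (norm_nonneg _)) |>.2
  have hT : ‖T q‖ ^ 2 ≤ ‖T‖ ^ 2 * ‖q‖ ^ 2 := by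
    rw [← mul_pow]
    exact pow_le_pow_left₀ (norm_nonneg _) (T.le_opNorm q) 2
  rw [norm_sub_sq_real, norm_smul, inner_smul_right, mul_pow, Real.norm_eq_abs, sq_abs]
  have h1 : η ^ 2 * ‖T q‖ ^ 2 ≤ η * lam * ‖q‖ ^ 2 := by
    calc η ^ 2 * ‖T q‖ ^ 2 ≤ η ^ 2 * (‖T‖ ^ 2 * ‖q‖ ^ 2) := by gcongr
      _ = η * (η * ‖T‖ ^ 2) * ‖q‖ ^ 2 := by ring
      _ ≤ η * lam * ‖q‖ ^ 2 := by gcongr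
  have h2 := mul_le_mul_of_nonneg_left hcoer hη
  nlinarith [sq_nonneg (η * lam * ‖q‖)]

/-- One step of the consensus recursion, seen through a projection `P` commuting with `T`. -/
theorem consensus_step (T P : E →L[ℝ] E) (hTP : ∀ v, T (P v) = T v) (hPT : ∀ v, P (T v) = T v)
    {z z' w h : E} {α η : ℝ}
    (hz : z' = (z - α • w) - η • T (z - α • w) - η • T h) :
    P z' = (P z - α • P w) - η • T (P z - α • P w) - η • T h := by
  rw [hz]
  simp only [map_sub, map_smul, hTP, hPT]

theorem consensus_step_norm_le_contract (T P : E →L[ℝ] E) (hTP : ∀ v, T (P v) = T v)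
    (hPT : ∀ v, P (T v) = T v) {lam : ℝ} (hcoer : ∀ v, lam * ‖P v‖ ^ 2 ≤ inner ℝ (P v) (T (P v)))
    {z z' w h : E} {α η W B : ℝ} (hα : 0 ≤ α) (hη : 0 ≤ η) (hlam : 0 ≤ lam)
    (hηT : η * ‖T‖ ^ 2 ≤ lam) (hη1 : η * lam ≤ 1) (hw : ‖w‖ ≤ W) (hh : ‖h‖ ≤ B)
    (hz : z' = (z - α • w) - η • T (z - α • w) - η • T h) :
    ‖P z'‖ ≤ (1 - η * lam / 2) * ‖P z‖ + (α * (‖P‖ * W) + η * (‖T‖ * B)) := by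
  rw [consensus_step T P hTP hPT hz, ← map_smul, ← map_sub]
  have h1 := norm_sub_smul_le_of_coercive T (hcoer (z - α • w)) hη hηT hη1
  have h2 : ‖P (z - α • w)‖ ≤ ‖P z‖ + α * (‖P‖ * W) := by
    rw [map_sub, map_smul]
    refine (norm_sub_le _ _).trans (add_le_add le_rfl ?_)
    rw [norm_smul, Real.norm_of_nonneg hα]
    gcongr
    exact P.le_opNorm_of_le hw
  have h3 : ‖η • T h‖ ≤ η * (‖T‖ * B) := by
    rw [norm_smul, Real.norm_of_nonneg hη]
    gcongr
    exact T.le_opNorm_of_le hh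
  have hPW : 0 ≤ α * (‖P‖ * W) :=
    mul_nonneg hα (mul_nonneg (norm_nonneg _) ((norm_nonneg _).trans hw))
  calc _ ≤ _ := norm_sub_le _ _
    _ ≤ (1 - η * lam / 2) * (‖P z‖ + α * (‖P‖ * W)) + η * (‖T‖ * B) :=
        add_le_add (h1.trans (mul_le_mul_of_nonneg_left h2 (by linarith))) h3
    _ ≤ _ := by nlinarith [mul_nonneg (mul_nonneg hη hlam) hPW]

/-- Crude growth bound for the finitely many early steps at which `η` may be too large for
contraction. -/
theorem consensus_step_norm_le (T P : E →L[ℝ] E) (hTP : ∀ v, T (P v) = T v)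
    (hPT : ∀ v, P (T v) = T v)
    {z z' w h : E} {α η W B : ℝ} (hα : 0 ≤ α) (hη : 0 ≤ η) (hw : ‖w‖ ≤ W) (hh : ‖h‖ ≤ B)
    (hz : z' = (z - α • w) - η • T (z - α • w) - η • T h) :
    ‖P z'‖ ≤ (1 + η * ‖T‖) * ‖P z‖ + ((1 + η * ‖T‖) * (α * (‖P‖ * W)) + η * (‖T‖ * B)) := by
  rw [consensus_step T P hTP hPT hz, ← map_smul, ← map_sub]
  have h2 : ‖P (z - α • w)‖ ≤ ‖P z‖ + α * (‖P‖ * W) := by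
    rw [map_sub, map_smul]
    refine (norm_sub_le _ _).trans (add_le_add le_rfl ?_)
    rw [norm_smul, Real.norm_of_nonneg hα]
    gcongr
    exact P.le_opNorm_of_le hw
  have h3 : ‖η • T h‖ ≤ η * (‖T‖ * B) := by
    rw [norm_smul, Real.norm_of_nonneg hη]
    gcongr
    exact T.le_opNorm_of_le hh
  have h1 : ‖P (z - α • w) - η • T (P (z - α • w))‖ ≤ (1 + η * ‖T‖) * ‖P (z - α • w)‖ := by
    refine (norm_sub_le _ _).trans ?_
    rw [norm_smul, Real.norm_of_nonneg hη]
    nlinarith [mul_le_mul_of_nonneg_left (T.le_opNorm (P (z - α • w))) hη]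
  calc _ ≤ _ := norm_sub_le _ _
    _ ≤ (1 + η * ‖T‖) * (‖P z‖ + α * (‖P‖ * W)) + η * (‖T‖ * B) :=
        add_le_add (h1.trans (mul_le_mul_of_nonneg_left h2 (by positivity))) h3
    _ = _ := by ring

/-- The disagreement of a consensus recursion with vanishing perturbation tends to zero. -/
theorem consensus_tendsto_zero (T P : E →L[ℝ] E) (hTP : ∀ v, T (P v) = T v)
    (hPT : ∀ v, P (T v) = T v) {lam : ℝ} (hlam : 0 < lam)
    (hcoer : ∀ v, lam * ‖P v‖ ^ 2 ≤ inner ℝ (P v) (T (P v)))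
    {α η : ℕ → ℝ} (hα : ∀ i, 0 ≤ α i) (hη : ∀ i, 0 < η i) (hη0 : Tendsto η atTop (𝓝 0))
    (hηdiv : Tendsto (fun n => ∑ i ∈ Finset.range n, η i) atTop atTop)
    (hαη : Tendsto (fun i => α i / η i) atTop (𝓝 0))
    {z w h : ℕ → E} {W : ℝ} (hw : ∀ i, ‖w i‖ ≤ W) (hh : Tendsto h atTop (𝓝 0))
    (hz : ∀ i, z (i + 1) = (z i - α i • w i) - η i • T (z i - α i • w i) - η i • T (h i)) :
    Tendsto (fun i => P (z i)) atTop (𝓝 0) := by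
  rw [tendsto_zero_iff_norm_tendsto_zero]
  have hsmall : ∀ c : ℝ, Tendsto (fun i => η i * c) atTop (𝓝 0) := fun c => by
    simpa using hη0.mul_const c
  refine tendsto_zero_of_le_averaging (a := fun i => η i * lam / 2)
    (g := fun i => 2 / lam * (α i / η i * (‖P‖ * W) + ‖T‖ * ‖h i‖)) (fun i => norm_nonneg _)
    (fun i => by have := hη i; positivity) ?_ ?_ ?_ ?_
  · filter_upwards [(hsmall lam).eventually_le_const one_pos] with i hi
    linarith
  · simp_rw [mul_div_assoc, ← Finset.sum_mul]
    exact hηdiv.atTop_mul_const (by positivity)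
  · have := ((hαη.mul_const (‖P‖ * W)).add (hh.norm.const_mul ‖T‖)).const_mul (2 / lam)
    simpa using this
  · filter_upwards [(hsmall lam).eventually_le_const one_pos,
      (hsmall (‖T‖ ^ 2)).eventually_le_const hlam] with i hi1 hi2
    refine (consensus_step_norm_le_contract T P hTP hPT hcoer (hα i) (hη i).le hlam.le hi2 hi1
      (hw i) le_rfl (hz i)).trans_eq ?_
    have := (hη i).ne'
    field_simp

/-- The disagreement of a consensus recursion is bounded linearly by its perturbation, uniformly
over all initial values of norm at most `X`. -/
theorem consensus_bounded (T P : E →L[ℝ] E) (hTP : ∀ v, T (P v) = T v)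
    (hPT : ∀ v, P (T v) = T v) {lam : ℝ} (hlam : 0 < lam)
    (hcoer : ∀ v, lam * ‖P v‖ ^ 2 ≤ inner ℝ (P v) (T (P v)))
    {α η : ℕ → ℝ} (hα : ∀ i, 0 ≤ α i) (hη : ∀ i, 0 < η i) (hη0 : Tendsto η atTop (𝓝 0))
    (hαη : Tendsto (fun i => α i / η i) atTop (𝓝 0)) {W X : ℝ} (hW : 0 ≤ W) (hX : 0 ≤ X) :
    ∃ C, 0 ≤ C ∧ ∀ (z w h : ℕ → E) (B : ℝ), ‖z 0‖ ≤ X → (∀ i, ‖w i‖ ≤ W) → (∀ i, ‖h i‖ ≤ B) →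
      (∀ i, z (i + 1) = (z i - α i • w i) - η i • T (z i - α i • w i) - η i • T (h i)) →
      ∀ i, ‖P (z i)‖ ≤ C * (1 + B) := by
  have hsmall : ∀ c : ℝ, Tendsto (fun i => η i * c) atTop (𝓝 0) := fun c => by
    simpa using hη0.mul_const c
  obtain ⟨i₀, hi₀⟩ := eventually_atTop.1 (((hsmall lam).eventually_le_const one_pos).and
    (((hsmall (‖T‖ ^ 2)).eventually_le_const hlam).and (hαη.eventually_le_const one_pos)))
  -- The comparison sequence `c` is fixed before any path is chosen, which makes the bound uniform;
  -- the perturbation size enters only through the factor `1 + B`. Before `i₀` it uses the crude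
  -- step, afterwards the contracting one.
  let k : ℕ → ℝ := fun i => if i₀ ≤ i then 1 - η i * lam / 2 else 1 + η i * ‖T‖
  let t : ℕ → ℝ := fun i => if i₀ ≤ i then α i * (‖P‖ * W) + η i * ‖T‖ else
    (1 + η i * ‖T‖) * (α i * (‖P‖ * W)) + η i * ‖T‖
  let c : ℕ → ℝ := fun i => Nat.rec (‖P‖ * X) (fun i r => k i * r + t i) i
  have hc : ∀ i, c (i + 1) = k i * c i + t i := fun i => rfl
  have hk0 : ∀ i, 0 ≤ k i := by
    intro i
    simp only [k]
    have := hη i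
    split_ifs with h
    · linarith [(hi₀ i h).1]
    · positivity
  have hbdd : BddAbove (Set.range c) := by
    -- After `i₀`, where `α ≤ η`, this `M` is the fixed point of `r ↦ (1 - ηλ/2) r + η (‖P‖ W +
    -- ‖T‖)`.
    refine bddAbove_range_of_eventually_le_max (M := 2 / lam * (‖P‖ * W + ‖T‖)) ?_
    filter_upwards [eventually_ge_atTop i₀] with i hi
    obtain ⟨h1, -, h3⟩ := hi₀ i hi
    have hηi := hη i
    rw [div_le_one hηi] at h3
    rw [hc]
    simp only [k, t, if_pos hi]
    set D := 2 / lam * (‖P‖ * W + ‖T‖) with hD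
    have hDD : η i * lam / 2 * D = η i * (‖P‖ * W + ‖T‖) := by
      rw [hD]; field_simp
    have h4 : α i * (‖P‖ * W) ≤ η i * (‖P‖ * W) := by gcongr
    have h5 : (1 - η i * lam / 2) * c i ≤ (1 - η i * lam / 2) * max (c i) D :=
      mul_le_mul_of_nonneg_left (le_max_left _ _) (by linarith)
    have h6 : η i * lam / 2 * D ≤ η i * lam / 2 * max (c i) D :=
      mul_le_mul_of_nonneg_left (le_max_right _ _) (by positivity)
    nlinarith
  obtain ⟨C, hC⟩ := hbdd
  have hC' : ∀ i, c i ≤ C := fun i => hC ⟨i, rfl⟩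
  refine ⟨C, (show (0 : ℝ) ≤ ‖P‖ * X by positivity).trans (hC' 0), fun z w h B hz0 hw hh hz => ?_⟩
  have hB : 0 ≤ B := (norm_nonneg _).trans (hh 0)
  have main : ∀ i, ‖P (z i)‖ ≤ c i * (1 + B) := by
    intro i
    induction i with
    | zero =>
      refine (P.le_opNorm_of_le hz0).trans ?_
      exact le_mul_of_one_le_right (by positivity : 0 ≤ ‖P‖ * X) (by linarith)
    | succ i ih =>
      have hηi := hη i
      have hαi := hα i
      have hstep : ‖P (z (i + 1))‖ ≤ k i * ‖P (z i)‖ + t i * (1 + B) := by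
        simp only [k, t]
        have a1 : 0 ≤ α i * (‖P‖ * W) := by positivity
        have a2 : 0 ≤ η i * ‖T‖ := by positivity
        split_ifs with hi
        · refine (consensus_step_norm_le_contract T P hTP hPT hcoer hαi hηi.le hlam.le
            (hi₀ i hi).2.1 (hi₀ i hi).1 (hw i) (hh i) (hz i)).trans ?_
          nlinarith [mul_nonneg a1 hB]
        · refine (consensus_step_norm_le T P hTP hPT hαi hηi.le (hw i) (hh i) (hz i)).trans ?_
          nlinarith [mul_nonneg a1 hB, mul_nonneg (mul_nonneg a2 a1) hB]
      rw [hc]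
      nlinarith [mul_le_mul_of_nonneg_left ih (hk0 i)]
  intro i
  exact (main i).trans (mul_le_mul_of_nonneg_right (hC' i) (by linarith))

end Consensus

/-! ### Averaging, centring and the graph Laplacian. -/

namespace DistQuantile

/-- The all-ones vector. -/
noncomputable def onesVec (N : ℕ) : EuclideanSpace ℝ (Fin N) := WithLp.toLp 2 1

@[simp] theorem onesVec_apply {N : ℕ} (n : Fin N) : onesVec N n = 1 := rfl

/-- The average of the entries of a vector. -/
noncomputable def meanCLM (N : ℕ) : EuclideanSpace ℝ (Fin N) →L[ℝ] ℝ :=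
  (1 / (N : ℝ)) • innerSL ℝ (onesVec N)

theorem meanCLM_apply {N : ℕ} (v : EuclideanSpace ℝ (Fin N)) :
    meanCLM N v = (1 / (N : ℝ)) * ∑ n, v n := by
  simp [meanCLM, PiLp.inner_apply]

theorem meanCLM_onesVec {N : ℕ} [NeZero N] : meanCLM N (onesVec N) = 1 := by
  simp [meanCLM_apply, NeZero.ne N]

/-- The deviation of a vector from its average. -/
noncomputable def centerCLM (N : ℕ) :
    EuclideanSpace ℝ (Fin N) →L[ℝ] EuclideanSpace ℝ (Fin N) :=
  ContinuousLinearMap.id ℝ _ - (meanCLM N).smulRight (onesVec N)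

theorem centerCLM_apply {N : ℕ} (v : EuclideanSpace ℝ (Fin N)) :
    centerCLM N v = v - meanCLM N v • onesVec N := by
  simp [centerCLM]

theorem meanCLM_centerCLM {N : ℕ} [NeZero N] (v : EuclideanSpace ℝ (Fin N)) :
    meanCLM N (centerCLM N v) = 0 := by
  simp [centerCLM_apply, meanCLM_onesVec]

/-- The Laplacian of a graph as an operator on Euclidean space. -/
noncomputable def lapCLM {N : ℕ} (G : SimpleGraph (Fin N)) [DecidableRel G.Adj] :
    EuclideanSpace ℝ (Fin N) →L[ℝ] EuclideanSpace ℝ (Fin N) :=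
  Matrix.toEuclideanCLM (𝕜 := ℝ) (G.lapMatrix ℝ)

section Laplacian

variable {N : ℕ} (G : SimpleGraph (Fin N)) [DecidableRel G.Adj]

theorem lapCLM_onesVec : lapCLM G (onesVec N) = 0 := by
  rw [lapCLM, onesVec, Matrix.toEuclideanCLM_toLp]
  have := G.lapMatrix_mulVec_const_eq_zero (R := ℝ)
  rw [show (1 : Fin N → ℝ) = fun _ => 1 from rfl, this]
  rfl

theorem meanCLM_lapCLM (v : EuclideanSpace ℝ (Fin N)) : meanCLM N (lapCLM G v) = 0 := by
  have h : inner ℝ (onesVec N) (lapCLM G v) = 0 := by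
    rw [lapCLM, Matrix.inner_toEuclideanCLM, Matrix.dotProduct_mulVec,
      ← Matrix.mulVec_transpose, G.isSymm_lapMatrix (R := ℝ)]
    have := G.lapMatrix_mulVec_const_eq_zero (R := ℝ)
    change (G.lapMatrix ℝ).mulVec (fun _ => 1) ⬝ᵥ _ = 0
    rw [this, zero_dotProduct]
  simp [meanCLM, h]

theorem lapCLM_centerCLM (v : EuclideanSpace ℝ (Fin N)) :
    lapCLM G (centerCLM N v) = lapCLM G v := by
  simp [centerCLM_apply, lapCLM_onesVec]

theorem centerCLM_lapCLM (v : EuclideanSpace ℝ (Fin N)) :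
    centerCLM N (lapCLM G v) = lapCLM G v := by
  simp [centerCLM_apply, meanCLM_lapCLM]

/-- The Laplacian form is a sum of squared edge differences, so it vanishes only on vectors constant
along the connected graph; mean zero then forces the vector to be zero. -/
theorem inner_lapCLM_pos (hG : G.Connected) {q : EuclideanSpace ℝ (Fin N)}
    (hq : meanCLM N q = 0) (hq0 : q ≠ 0) : 0 < inner ℝ q (lapCLM G q) := by
  have : Nonempty (Fin N) := hG.nonempty
  have hN : (N : ℝ) ≠ 0 := by
    have := Fin.pos_iff_nonempty.2 this
    positivity
  have heq : inner ℝ q (lapCLM G q) = Matrix.toLinearMap₂' ℝ (G.lapMatrix ℝ) (⇑q) (⇑q) := by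
    rw [lapCLM, Matrix.inner_toEuclideanCLM, Matrix.toLinearMap₂'_apply']
  rw [heq]
  refine lt_of_le_of_ne ?_ fun h => hq0 ?_
  · rw [SimpleGraph.lapMatrix_toLinearMap₂']
    positivity
  · have h1 := (G.lapMatrix_toLinearMap₂'_apply'_eq_zero_iff_forall_reachable _).1 h.symm
    ext n
    have h2 : ∀ m, q m = q n := fun m => h1 m n (hG.preconnected m n)
    rw [meanCLM_apply] at hq
    simp only [h2, Finset.sum_const, Finset.card_univ, Fintype.card_fin, nsmul_eq_mul] at hq
    field_simp at hq
    simpa using hq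

/-- The spectral gap of the Laplacian of a connected graph. -/
theorem exists_lapCLM_coercive (hG : G.Connected) :
    ∃ lam : ℝ, 0 < lam ∧ ∀ v : EuclideanSpace ℝ (Fin N),
      lam * ‖centerCLM N v‖ ^ 2 ≤ inner ℝ (centerCLM N v) (lapCLM G (centerCLM N v)) := by
  have hne : Nonempty (Fin N) := hG.nonempty
  have : NeZero N := ⟨(Fin.pos_iff_nonempty.2 hne).ne'⟩
  let K : Set (EuclideanSpace ℝ (Fin N)) := Metric.sphere 0 1 ∩ {q | meanCLM N q = 0}
  have hK : IsCompact K :=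
    (isCompact_sphere 0 1).inter_right (isClosed_eq (meanCLM N).continuous continuous_const)
  have hpos : ∀ q ∈ K, 0 < inner ℝ q (lapCLM G q) := fun q hq =>
    inner_lapCLM_pos G hG hq.2 (by
      rintro rfl
      simpa using hq.1)
  have hlow : ∃ lam : ℝ, 0 < lam ∧ ∀ q ∈ K, lam ≤ inner ℝ q (lapCLM G q) := by
    -- The compact set `K` is empty when there is a single node.
    rcases K.eq_empty_or_nonempty with h | h
    · exact ⟨1, one_pos, by simp [h]⟩
    · obtain ⟨q₀, hq₀, hmin⟩ := hK.exists_isMinOn h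
        (f := fun q => inner ℝ q (lapCLM G q)) (by fun_prop)
      exact ⟨_, hpos q₀ hq₀, fun q hq => hmin hq⟩
  obtain ⟨lam, hlam, hle⟩ := hlow
  refine ⟨lam, hlam, fun v => ?_⟩
  set q := centerCLM N v with hq
  have hmq : meanCLM N q = 0 := meanCLM_centerCLM v
  rcases eq_or_ne q 0 with h0 | h0
  · simp [h0]
  · have hn : ‖q‖ ≠ 0 := norm_ne_zero_iff.2 h0
    have hmem : ‖q‖⁻¹ • q ∈ K := by
      refine ⟨?_, ?_⟩
      · simp [norm_smul, hn]
      · simp [hmq]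
    have := hle _ hmem
    rw [map_smul, inner_smul_left, inner_smul_right] at this
    simp only [conj_trivial] at this
    calc lam * ‖q‖ ^ 2 ≤ ‖q‖⁻¹ * (‖q‖⁻¹ * inner ℝ q (lapCLM G q)) * ‖q‖ ^ 2 := by gcongr
      _ = _ := by field_simp

end Laplacian

/-! ### The empirical quantile and the sign and size of the mean innovation. -/

section Quantile

theorem unitStep_mono : Monotone unitStep := by
  intro a b hab
  unfold unitStep
  split_ifs with h1 h2
  · norm_num
  · exact absurd (h1.trans hab) h2
  · norm_num
  · norm_num

theorem unitStep_nonneg (t : ℝ) : 0 ≤ unitStep t := by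
  unfold unitStep; split_ifs <;> norm_num

theorem unitStep_le_one (t : ℝ) : unitStep t ≤ 1 := by
  unfold unitStep; split_ifs <;> norm_num

theorem measurable_unitStep : Measurable unitStep := unitStep_mono.measurable

theorem eventually_unitStep_sub_eq (a θ : ℝ) :
    ∀ᶠ w in 𝓝[≥] θ, unitStep (w - a) = unitStep (θ - a) := by
  rcases le_or_gt a θ with h | h
  · filter_upwards [self_mem_nhdsWithin] with w hw
    have hw : θ ≤ w := hw
    simp [unitStep, h, h.trans hw]
  · filter_upwards [nhdsWithin_le_nhds (Iio_mem_nhds h)] with w hw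
    have hw : w < a := hw
    simp [unitStep, h.not_ge, hw.not_ge]

variable {N : ℕ} (x : Fin N → ℝ) {p : ℝ}

theorem ecdf_set_nonempty [NeZero N] (hp1 : p < 1) : {w : ℝ | p ≤ ecdf x w}.Nonempty := by
  refine ⟨∑ n, |x n|, ?_⟩
  have h : ∀ n, unitStep (∑ m, |x m| - x n) = 1 := fun n => by
    have := Finset.single_le_sum (f := fun m => |x m|) (fun m _ => abs_nonneg _)
      (Finset.mem_univ n)
    have h2 : x n ≤ ∑ m, |x m| := (le_abs_self _).trans this
    simp [unitStep, h2]
  simp [ecdf, h, NeZero.ne N, hp1.le]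

theorem ecdf_set_bddBelow (hp0 : 0 < p) : BddBelow {w : ℝ | p ≤ ecdf x w} := by
  refine ⟨-∑ n, |x n|, fun w hw => ?_⟩
  by_contra! hlt
  have h : ∀ n, unitStep (w - x n) = 0 := fun n => by
    have := Finset.single_le_sum (f := fun m => |x m|) (fun m _ => abs_nonneg _)
      (Finset.mem_univ n)
    have h2 : w < x n := by linarith [neg_abs_le (x n)]
    simp [unitStep, h2]
  simp only [Set.mem_ofPred_eq, ecdf, h] at hw
  simp at hw
  linarith

/-- The empirical CDF attains the level `p` at the `p`-quantile. -/
theorem le_ecdf_quantile [NeZero N] (hp0 : 0 < p) (hp1 : p < 1) : p ≤ ecdf x (quantile x p) := by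
  have hglb := isGLB_csInf (ecdf_set_nonempty x hp1) (ecdf_set_bddBelow x hp0)
  -- Points of the set occur arbitrarily close to the infimum on its right, where the step functions
  -- are locally constant.
  have hfreq := hglb.frequently_mem (ecdf_set_nonempty x hp1)
  have hev : ∀ᶠ w in 𝓝[≥] (quantile x p), ∀ n,
      unitStep (w - x n) = unitStep (quantile x p - x n) :=
    eventually_all.2 fun n => eventually_unitStep_sub_eq (x n) _
  obtain ⟨w, hw, hw'⟩ := (hfreq.and_eventually hev).exists
  simp only [Set.mem_ofPred_eq, ecdf, hw'] at hw
  exact hw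

theorem ecdf_lt_of_lt_quantile (hp0 : 0 < p) {w : ℝ} (hw : w < quantile x p) :
    ecdf x w < p := by
  by_contra! h
  exact absurd (csInf_le (ecdf_set_bddBelow x hp0) h) (not_le.2 hw)

/-- The innovation as a vector of Euclidean space. -/
noncomputable def innovationVec {N : ℕ} (x : Fin N → ℝ) (p : ℝ)
    (w : EuclideanSpace ℝ (Fin N)) : EuclideanSpace ℝ (Fin N) :=
  WithLp.toLp 2 (innovation x p w)

theorem meanCLM_innovationVec [NeZero N] (w : EuclideanSpace ℝ (Fin N)) :
    meanCLM N (innovationVec x p w) = (1 / (N : ℝ)) * ∑ n, unitStep (w n - x n) - p := by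
  have : (N : ℝ) ≠ 0 := by simp [NeZero.ne N]
  rw [meanCLM_apply]
  simp only [innovationVec, innovation, Finset.sum_sub_distrib, Finset.sum_const,
    Finset.card_univ, Fintype.card_fin, nsmul_eq_mul]
  field_simp

theorem abs_innovationVec_apply_le (hp0 : 0 < p) (hp1 : p < 1) (w : EuclideanSpace ℝ (Fin N))
    (n : Fin N) : |innovationVec x p w n| ≤ 1 := by
  have h1 := unitStep_nonneg (w n - x n)
  have h2 := unitStep_le_one (w n - x n)
  change |unitStep (w n - x n) - p| ≤ 1
  rw [abs_le]
  constructor <;> linarith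

theorem norm_innovationVec_le (hp0 : 0 < p) (hp1 : p < 1) (w : EuclideanSpace ℝ (Fin N)) :
    ‖innovationVec x p w‖ ≤ √N := by
  rw [EuclideanSpace.norm_eq]
  refine Real.sqrt_le_sqrt ?_
  calc ∑ n, ‖innovationVec x p w n‖ ^ 2 ≤ ∑ _n : Fin N, (1 : ℝ) := by
        refine Finset.sum_le_sum fun n _ => pow_le_one₀ (norm_nonneg _) ?_
        exact abs_innovationVec_apply_le x hp0 hp1 w n
    _ = N := by simp

theorem abs_meanCLM_innovationVec_le [NeZero N] (hp0 : 0 < p) (hp1 : p < 1)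
    (w : EuclideanSpace ℝ (Fin N)) : |meanCLM N (innovationVec x p w)| ≤ 1 := by
  have hN : (0 : ℝ) < N := by exact_mod_cast NeZero.pos N
  rw [meanCLM_apply, abs_mul, abs_of_pos (by positivity)]
  have : |∑ n, innovationVec x p w n| ≤ N :=
    (Finset.abs_sum_le_sum_abs _ _).trans <|
      (Finset.sum_le_sum fun n _ => abs_innovationVec_apply_le x hp0 hp1 w n).trans (by simp)
  rw [one_div, inv_mul_le_iff₀ hN]
  simpa using this

/-- As `p` is not a multiple of `1 / N`, the average innovation is bounded away from zero. -/
theorem exists_le_abs_meanCLM_innovationVec [NeZero N] (hp0 : 0 < p)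
    (hpN : ∀ k ∈ Finset.Icc 1 N, p ≠ (k : ℝ) / (N : ℝ)) :
    ∃ δ : ℝ, 0 < δ ∧ ∀ w : EuclideanSpace ℝ (Fin N),
      δ ≤ |meanCLM N (innovationVec x p w)| := by
  -- The mean innovation is `k / N - p`, with `k` the number of nodes where `x n ≤ w n`; so `δ` is
  -- the least distance from `p` to such fractions. The value `k = 0` is excluded by `0 < p`.
  obtain ⟨k₀, hmem, hk₀⟩ := Finset.exists_min_image (Finset.range (N + 1))
    (fun k : ℕ => |(k : ℝ) / N - p|) ⟨0, by simp⟩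
  refine ⟨|(k₀ : ℝ) / N - p|, abs_pos.2 (sub_ne_zero.2 ?_), fun w => ?_⟩
  · rcases Nat.eq_zero_or_pos k₀ with rfl | hk
    · simpa using hp0.ne
    · exact (hpN k₀ (Finset.mem_Icc.2 ⟨hk, Nat.lt_succ_iff.1 (Finset.mem_range.1 hmem)⟩)).symm
  · refine (hk₀ (Finset.univ.filter fun n => 0 ≤ w n - x n).card ?_).trans_eq ?_
    · rw [Finset.mem_range, Nat.lt_succ_iff]
      exact (Finset.card_le_univ _).trans_eq (by simp)
    · rw [meanCLM_innovationVec]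
      congr 2
      simp only [unitStep]
      rw [Finset.sum_boole, one_div, div_eq_inv_mul]

theorem meanCLM_innovationVec_nonneg [NeZero N] (hp0 : 0 < p) (hp1 : p < 1)
    {w : EuclideanSpace ℝ (Fin N)} (hw : ∀ n, quantile x p ≤ w n) :
    0 ≤ meanCLM N (innovationVec x p w) := by
  rw [meanCLM_innovationVec, sub_nonneg]
  refine (le_ecdf_quantile x hp0 hp1).trans ?_
  unfold ecdf
  gcongr with n
  exact unitStep_mono (by linarith [hw n])

/-- Compare with the empirical CDF at the largest coordinate. Strict inequality is essential, as the
CDF already reaches `p` at the quantile. -/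
theorem meanCLM_innovationVec_nonpos [NeZero N] (hp0 : 0 < p)
    {w : EuclideanSpace ℝ (Fin N)} (hw : ∀ n, w n < quantile x p) :
    meanCLM N (innovationVec x p w) ≤ 0 := by
  have : Nonempty (Fin N) := Fin.pos_iff_nonempty.1 (NeZero.pos N)
  obtain ⟨m, hm⟩ := Finite.exists_max (fun n => w n)
  rw [meanCLM_innovationVec, sub_nonpos]
  refine le_trans ?_ (ecdf_lt_of_lt_quantile x hp0 (hw m)).le
  unfold ecdf
  gcongr with n
  exact unitStep_mono (by linarith [hm n])

end Quantile

end DistQuantile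

/-! ### Doob's inequality and convergence of independent series. -/

/-- The running maximum of the partial sums of `d`, including the empty sum. -/
noncomputable def runningMax (d : ℕ → ℝ) : ℕ → ℝ
  | 0 => 0
  | n + 1 => max (runningMax d n) (∑ i ∈ Finset.range (n + 1), d i)

theorem runningMax_nonneg (d : ℕ → ℝ) (n : ℕ) : 0 ≤ runningMax d n := by
  induction n with
  | zero => exact le_rfl
  | succ n ih => exact le_max_of_le_left ih

theorem monotone_runningMax (d : ℕ → ℝ) : Monotone (runningMax d) :=
  monotone_nat_of_le_succ fun _ => le_max_left _ _

theorem sum_le_runningMax (d : ℕ → ℝ) (n : ℕ) : ∑ i ∈ Finset.range n, d i ≤ runningMax d n := by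
  cases n with
  | zero => simp [runningMax]
  | succ n => exact le_max_right _ _

/-- Pathwise form of Doob's `L²` maximal inequality. -/
theorem runningMax_sq_add_le (d : ℕ → ℝ) (n : ℕ) :
    runningMax d n ^ 2 + 4 * ∑ k ∈ Finset.range n, runningMax d k * d k
      ≤ 4 * (∑ k ∈ Finset.range n, d k) ^ 2 := by
  -- Summation by parts: the maximum changes only when it equals the new partial sum. The claim then
  -- follows from `(M - 2S)² ≥ 0`.
  have key : ∑ k ∈ Finset.range n, runningMax d k * d k
      ≤ runningMax d n * ∑ k ∈ Finset.range n, d k - runningMax d n ^ 2 / 2 := by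
    induction n with
    | zero => simp [runningMax]
    | succ n ih =>
      rw [Finset.sum_range_succ, show runningMax d (n + 1) =
        max (runningMax d n) (∑ i ∈ Finset.range (n + 1), d i) from rfl]
      have hS : ∑ i ∈ Finset.range (n + 1), d i = ∑ i ∈ Finset.range n, d i + d n :=
        Finset.sum_range_succ _ _
      rcases le_total (∑ i ∈ Finset.range (n + 1), d i) (runningMax d n) with h | h
      · rw [max_eq_left h, hS]
        linarith
      · rw [max_eq_right h, hS]
        nlinarith [sq_nonneg (∑ i ∈ Finset.range n, d i + d n - runningMax d n)]
  nlinarith [sq_nonneg (runningMax d n - 2 * ∑ k ∈ Finset.range n, d k)]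

theorem measurable_runningMax {Ω : Type*} {m : MeasurableSpace Ω} {d : ℕ → Ω → ℝ} (n : ℕ)
    (hd : ∀ i < n, Measurable (d i)) : Measurable fun s => runningMax (fun i => d i s) n := by
  induction n with
  | zero => exact measurable_const
  | succ n ih =>
    refine (ih fun i hi => hd i (by omega)).max ?_
    exact Finset.measurable_sum _ fun i hi => hd i (Finset.mem_range.1 hi)

theorem measurable_past {Ω : Type*} {d : ℕ → Ω → ℝ} {i n : ℕ} (hi : i < n) :
    Measurable[⨆ i ∈ Set.Iio n, MeasurableSpace.comap (d i) inferInstance] (d i) := by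
  refine Measurable.mono (comap_measurable (d i)) ?_ le_rfl
  exact le_iSup₂_of_le i (show i ∈ Set.Iio n from hi) le_rfl

section Independent

variable {Ω : Type*} [mΩ : MeasurableSpace Ω] {P : Measure Ω}
  {d : ℕ → Ω → ℝ}

theorem memLp_runningMax (hL : ∀ i, MemLp (d i) 2 P) (n : ℕ) :
    MemLp (fun s => runningMax (fun i => d i s) n) 2 P := by
  induction n with
  | zero => exact MemLp.zero
  | succ n ih => exact ih.sup (memLp_finsetSum _ fun i _ => hL i)

theorem indepFun_past (hd : ∀ i, Measurable (d i)) (hind : iIndepFun d P) {f : Ω → ℝ} {n : ℕ}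
    (hf : Measurable[⨆ i ∈ Set.Iio n, MeasurableSpace.comap (d i) inferInstance] f) :
    IndepFun f (d n) P := by
  have h := indep_iSup_of_disjoint (fun i => (hd i).comap_le) hind
    (show Disjoint (Set.Iio n) {n} by simp)
  refine indep_of_indep_of_le_left (indep_of_indep_of_le_right h ?_) hf.comap_le
  simp

theorem integral_mul_eq_zero_of_past (hd : ∀ i, Measurable (d i)) (hind : iIndepFun d P)
    (hmean : ∀ i, ∫ s, d i s ∂P = 0) {f : Ω → ℝ} {n : ℕ}
    (hf : Measurable[⨆ i ∈ Set.Iio n, MeasurableSpace.comap (d i) inferInstance] f) :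
    ∫ s, f s * d n s ∂P = 0 := by
  have hle : (⨆ i ∈ Set.Iio n, MeasurableSpace.comap (d i) inferInstance) ≤ mΩ :=
    iSup₂_le fun i _ => (hd i).comap_le
  rw [(indepFun_past hd hind hf).integral_fun_mul_eq_mul_integral
    (hf.mono hle le_rfl).aestronglyMeasurable (hd n).aestronglyMeasurable, hmean, mul_zero]

theorem integral_sum_sq (hd : ∀ i, Measurable (d i)) (hind : iIndepFun d P)
    (hL : ∀ i, MemLp (d i) 2 P) (hmean : ∀ i, ∫ s, d i s ∂P = 0) (n : ℕ) :
    ∫ s, (∑ i ∈ Finset.range n, d i s) ^ 2 ∂P = ∑ i ∈ Finset.range n, ∫ s, d i s ^ 2 ∂P := by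
  induction n with
  | zero => simp
  | succ n ih =>
    have hS : MemLp (fun s => ∑ i ∈ Finset.range n, d i s) 2 P := memLp_finsetSum _ fun i _ => hL i
    have h0 : ∫ s, (∑ i ∈ Finset.range n, d i s) * d n s ∂P = 0 :=
      integral_mul_eq_zero_of_past hd hind hmean
        (Finset.measurable_sum _ fun i hi => measurable_past (Finset.mem_range.1 hi))
    have hi : Integrable (fun s => (∑ i ∈ Finset.range n, d i s) * d n s) P :=
      hS.integrable_mul (hL n)
    simp_rw [Finset.sum_range_succ, add_sq, mul_assoc]
    rw [integral_add (f := fun s => (∑ i ∈ Finset.range n, d i s) ^ 2 +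
        2 * ((∑ i ∈ Finset.range n, d i s) * d n s))
      (hS.integrable_sq.add (hi.const_mul 2)) (hL n).integrable_sq,
      integral_add hS.integrable_sq (hi.const_mul 2), integral_const_mul, h0, ih]
    simp

/-- Integrate the pathwise inequality. Its cross terms have mean zero because `runningMax d k`
depends only on the `d i` with `i < k`. -/
theorem integral_runningMax_sq_le (hd : ∀ i, Measurable (d i)) (hind : iIndepFun d P)
    (hL : ∀ i, MemLp (d i) 2 P) (hmean : ∀ i, ∫ s, d i s ∂P = 0) (n : ℕ) :
    ∫ s, runningMax (fun i => d i s) n ^ 2 ∂P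
      ≤ 4 * ∑ i ∈ Finset.range n, ∫ s, d i s ^ 2 ∂P := by
  have hS : MemLp (fun s => ∑ i ∈ Finset.range n, d i s) 2 P := memLp_finsetSum _ fun i _ => hL i
  have hi : ∀ k ∈ Finset.range n, Integrable (fun s => runningMax (fun i => d i s) k * d k s) P :=
    fun k _ => (memLp_runningMax hL k).integrable_mul (hL k)
  have h := integral_mono
    ((memLp_runningMax hL n).integrable_sq.add ((integrable_finsetSum _ hi).const_mul 4))
    (hS.integrable_sq.const_mul 4) (fun s => runningMax_sq_add_le (fun i => d i s) n)
  rw [integral_add' (memLp_runningMax hL n).integrable_sq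
    ((integrable_finsetSum _ hi).const_mul 4), integral_const_mul, integral_const_mul,
    integral_finsetSum _ hi, integral_sum_sq hd hind hL hmean] at h
  rw [Finset.sum_eq_zero (fun k _ => integral_mul_eq_zero_of_past hd hind hmean
    (measurable_runningMax k fun i hi => measurable_past hi))] at h
  simpa using h

/-- The running maxima of the partial sums of a square-summable independent centred sequence are
dominated by a single square-integrable function. -/
theorem exists_integrable_runningMax_sq_le (hd : ∀ i, Measurable (d i)) (hind : iIndepFun d P)
    (hL : ∀ i, MemLp (d i) 2 P) (hmean : ∀ i, ∫ s, d i s ∂P = 0)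
    (hsum : Summable fun i => ∫ s, d i s ^ 2 ∂P) :
    ∃ g : Ω → ℝ, Integrable g P ∧ ∀ᵐ s ∂P, ∀ n, runningMax (fun i => d i s) n ^ 2 ≤ g s := by
  let F : ℕ → Ω → ENNReal := fun n s => ENNReal.ofReal (runningMax (fun i => d i s) n ^ 2)
  have hF : ∀ n, Measurable (F n) := fun n =>
    ((measurable_runningMax n fun i _ => hd i).pow_const 2).ennreal_ofReal
  have hmono : Monotone F := fun m n hmn s => ENNReal.ofReal_le_ofReal
    (pow_le_pow_left₀ (runningMax_nonneg _ _) (monotone_runningMax _ hmn) 2)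
  have hfin : ∫⁻ s, ⨆ n, F n s ∂P ≠ ⊤ := by
    rw [lintegral_iSup hF hmono]
    refine ne_top_of_le_ne_top
      (ENNReal.ofReal_ne_top (r := 4 * ∑' i, ∫ s, d i s ^ 2 ∂P)) (iSup_le fun n => ?_)
    rw [← ofReal_integral_eq_lintegral_ofReal (memLp_runningMax hL n).integrable_sq
      (ae_of_all _ fun s => sq_nonneg _)]
    refine ENNReal.ofReal_le_ofReal ((integral_runningMax_sq_le hd hind hL hmean n).trans ?_)
    gcongr
    exact hsum.sum_le_tsum _ fun i _ => integral_nonneg fun s => sq_nonneg _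
  refine ⟨fun s => (⨆ n, F n s).toReal,
    integrable_toReal_of_lintegral_ne_top (Measurable.iSup hF).aemeasurable hfin, ?_⟩
  filter_upwards [ae_lt_top (Measurable.iSup hF) hfin] with s hs n
  rw [← ENNReal.ofReal_le_iff_le_toReal hs.ne]
  exact le_iSup (fun n => F n s) n

/-- `L²` domination of the partial sums of a square-summable independent centred sequence. -/
theorem exists_integrable_sum_sq_le (hd : ∀ i, Measurable (d i)) (hind : iIndepFun d P)
    (hL : ∀ i, MemLp (d i) 2 P) (hmean : ∀ i, ∫ s, d i s ∂P = 0)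
    (hsum : Summable fun i => ∫ s, d i s ^ 2 ∂P) :
    ∃ g : Ω → ℝ, Integrable g P ∧ ∀ᵐ s ∂P, ∀ n, (∑ i ∈ Finset.range n, d i s) ^ 2 ≤ g s := by
  obtain ⟨g₁, hg₁, h₁⟩ := exists_integrable_runningMax_sq_le hd hind hL hmean hsum
  obtain ⟨g₂, hg₂, h₂⟩ := exists_integrable_runningMax_sq_le (d := fun i s => -d i s)
    (fun i => (hd i).neg) (hind.comp (fun _ => Neg.neg) fun _ => measurable_neg)
    (fun i => (hL i).neg) (fun i => by rw [integral_neg, hmean, neg_zero])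
    (by simpa using hsum)
  refine ⟨fun s => g₁ s + g₂ s, hg₁.add hg₂, ?_⟩
  filter_upwards [h₁, h₂] with s hs₁ hs₂ n
  have a₁ := hs₁ n
  have a₂ := hs₂ n
  have b₁ := sum_le_runningMax (fun i => d i s) n
  have b₂ := sum_le_runningMax (fun i => -d i s) n
  rw [Finset.sum_neg_distrib] at b₂
  rcases le_total 0 (∑ i ∈ Finset.range n, d i s) with h | h
  · nlinarith [sq_nonneg (runningMax (fun i => -d i s) n)]
  · nlinarith [sq_nonneg (runningMax (fun i => d i s) n)]

/-- A square-summable independent centred series converges almost surely. -/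
theorem ae_exists_tendsto_sum [IsFiniteMeasure P] (hd : ∀ i, Measurable (d i)) (hind : iIndepFun d P)
    (hL : ∀ i, MemLp (d i) 2 P) (hmean : ∀ i, ∫ s, d i s ∂P = 0)
    (hsum : Summable fun i => ∫ s, d i s ^ 2 ∂P) :
    ∀ᵐ s ∂P, ∃ c, Tendsto (fun n => ∑ i ∈ Finset.range n, d i s) atTop (𝓝 c) := by
  have hsm : ∀ i, StronglyMeasurable (d i) := fun i => (hd i).stronglyMeasurable
  let ℱ := Filtration.natural d hsm
  have hint : ∀ i, Integrable (d i) P := fun i => (hL i).integrable one_le_two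
  -- The shift to `n + 1` summands matches the natural filtration, which at time `n` already
  -- contains `d n`.
  have hmart : Martingale (fun n s => ∑ i ∈ Finset.range (n + 1), d i s) ℱ P := by
    refine martingale_of_condExp_sub_eq_zero_nat (fun n => ?_)
      (fun n => integrable_finsetSum _ fun i _ => hint i) (fun n => ?_)
    · refine Finset.stronglyMeasurable_fun_sum _ fun i hi => ?_
      exact (Filtration.stronglyAdapted_natural hsm i).mono
        (ℱ.mono (Nat.lt_succ_iff.1 (Finset.mem_range.1 hi)))
    · have : ((fun s => ∑ i ∈ Finset.range (n + 1 + 1), d i s) -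
          fun s => ∑ i ∈ Finset.range (n + 1), d i s) = d (n + 1) := by
        ext s
        simp [Finset.sum_range_succ _ (n + 1)]
      rw [this]
      filter_upwards [hind.condExp_natural_ae_eq_of_lt hsm n.lt_succ_self] with s hs
      rw [hs, hmean]
      rfl
  obtain ⟨g, hg, hle⟩ := exists_integrable_sum_sq_le hd hind hL hmean hsum
  -- Bounded in `L¹` through `|S| ≤ 1 + S² ≤ 1 + g`.
  have hbdd : ∀ n, eLpNorm (fun s => ∑ i ∈ Finset.range (n + 1), d i s) 1 P
      ≤ ((∫⁻ s, ENNReal.ofReal (1 + g s) ∂P).toNNReal : ENNReal) := by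
    intro n
    rw [ENNReal.coe_toNNReal, eLpNorm_one_eq_lintegral_enorm]
    · refine lintegral_mono_ae ?_
      filter_upwards [hle] with s hs
      rw [Real.enorm_eq_ofReal_abs]
      refine ENNReal.ofReal_le_ofReal ?_
      have := hs (n + 1)
      rw [← sq_abs] at this
      nlinarith [sq_nonneg (|∑ i ∈ Finset.range (n + 1), d i s| - 1)]
    · exact ((integrable_const 1).add hg).lintegral_lt_top.ne
  filter_upwards [hmart.submartingale.exists_ae_tendsto_of_bdd hbdd] with s ⟨c, hc⟩
  exact ⟨c, (tendsto_add_atTop_iff_nat 1).1 hc⟩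

end Independent

/-! ### Deterministic analysis of a single path. -/

namespace DistQuantile

section Pathwise

variable {N : ℕ} {G : SimpleGraph (Fin N)} [DecidableRel G.Adj] {x : Fin N → ℝ}
  {p : ℝ} {α η : ℕ → ℝ}

/-- The recursion of the algorithm, driven by the increments of `h`. -/
def IsPath (G : SimpleGraph (Fin N)) [DecidableRel G.Adj] (x : Fin N → ℝ) (p : ℝ) (α η : ℕ → ℝ)
    (w h : ℕ → EuclideanSpace ℝ (Fin N)) : Prop :=
  ∀ i, w (i + 1) = (w i - α i • innovationVec x p (w i))
    - η i • lapCLM G (w i - α i • innovationVec x p (w i)) + (h (i + 1) - h i)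

/-- The innovation is still evaluated at `w i`, not at `w i - h i`; only its boundedness and sign
are needed later. -/
theorem IsPath.sub_succ {w h : ℕ → EuclideanSpace ℝ (Fin N)} (hw : IsPath G x p α η w h) (i : ℕ) :
    w (i + 1) - h (i + 1) = (w i - h i - α i • innovationVec x p (w i))
      - η i • lapCLM G (w i - h i - α i • innovationVec x p (w i)) - η i • lapCLM G (h i) := by
  rw [hw i]
  simp only [map_sub, map_smul, smul_sub]
  abel

theorem norm_sub_smul_onesVec_le (θ : ℝ) (v u : EuclideanSpace ℝ (Fin N)) :
    ‖v - θ • onesVec N‖ ≤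
      |meanCLM N (v - u) - θ| * ‖onesVec N‖ + (‖centerCLM N (v - u)‖ + ‖u‖) := by
  have h : v - θ • onesVec N =
      (meanCLM N (v - u) - θ) • onesVec N + (centerCLM N (v - u) + u) := by
    rw [centerCLM_apply, sub_smul]
    abel
  rw [h]
  refine (norm_add_le _ _).trans (add_le_add ?_ (norm_add_le _ _))
  rw [norm_smul, Real.norm_eq_abs]

/-- Away from the quantile the average of the network moves towards the quantile. -/
theorem IsPath.abs_mean_succ_le [NeZero N] (hp0 : 0 < p) (hp1 : p < 1) {δ : ℝ}
    (hδ : ∀ w : EuclideanSpace ℝ (Fin N), δ ≤ |meanCLM N (innovationVec x p w)|)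
    (hα : ∀ i, 0 ≤ α i) {w h : ℕ → EuclideanSpace ℝ (Fin N)} (hw : IsPath G x p α η w h) (i : ℕ) :
    |meanCLM N (w (i + 1) - h (i + 1)) - quantile x p| ≤
      max (|meanCLM N (w i - h i) - quantile x p| - α i * δ)
        (‖centerCLM N (w i - h i)‖ + ‖h i‖ + α i) := by
  set θ := quantile x p
  set c := meanCLM N (w i - h i) - θ with hc
  set e := ‖centerCLM N (w i - h i)‖ + ‖h i‖ with he
  set y := meanCLM N (innovationVec x p (w i)) with hy
  have hstep : meanCLM N (w (i + 1) - h (i + 1)) - θ = c - α i * y := by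
    rw [hw.sub_succ i]
    simp only [map_sub, map_smul, meanCLM_lapCLM, smul_eq_mul, hc, hy]
    ring
  have hcoord : ∀ n, |w i n - θ - c| ≤ e := by
    intro n
    have h1 : w i n - θ - c = (centerCLM N (w i - h i) + h i) n := by
      rw [centerCLM_apply, hc]
      simp
      ring
    rw [h1, ← Real.norm_eq_abs]
    exact (PiLp.norm_apply_le _ n).trans (norm_add_le _ _)
  have hy1 := abs_le.1 (abs_meanCLM_innovationVec_le x hp0 hp1 (w i))
  rw [← hy] at hy1
  have hαi := hα i
  have he0 : 0 ≤ e := by positivity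
  have hα1 : α i * y ≤ α i := by nlinarith
  have hα2 : -α i ≤ α i * y := by nlinarith
  rw [hstep]
  -- By `hcoord`, `|c| > e` puts all coordinates on one side of the quantile. The step then either
  -- gains `α δ` or overshoots by at most `α`; if `|c| ≤ e`, the new distance is at most `e + α`.
  rcases le_or_gt e c with h1 | h1
  · have hy0 : 0 ≤ y := meanCLM_innovationVec_nonneg x hp0 hp1 fun n => by
      have := (abs_le.1 (hcoord n)).1
      linarith
    have hyδ : δ ≤ y := by simpa [← hy, abs_of_nonneg hy0] using hδ (w i)
    have := mul_le_mul_of_nonneg_left hyδ hαi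
    rcases le_total 0 (c - α i * y) with h2 | h2
    · refine le_max_of_le_left ?_
      rw [abs_of_nonneg h2, abs_of_nonneg (he0.trans h1)]
      linarith
    · refine le_max_of_le_right ?_
      rw [abs_of_nonpos h2]
      linarith
  · rcases lt_or_ge c (-e) with h3 | h3
    · have hy0 : y ≤ 0 := meanCLM_innovationVec_nonpos x hp0 fun n => by
        have := (abs_le.1 (hcoord n)).2
        linarith
      have hyδ : δ ≤ -y := by simpa [← hy, abs_of_nonpos hy0] using hδ (w i)
      have := mul_le_mul_of_nonneg_left hyδ hαi
      rcases le_total 0 (c - α i * y) with h2 | h2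
      · refine le_max_of_le_right ?_
        rw [abs_of_nonneg h2]
        linarith
      · refine le_max_of_le_left ?_
        rw [abs_of_nonpos h2, abs_of_nonpos (by linarith)]
        linarith
    · refine le_max_of_le_right (abs_le.2 ⟨?_, ?_⟩) <;> linarith

/-- If the accumulated noise converges then the path converges to the quantile. -/
theorem IsPath.tendsto [NeZero N] (hG : G.Connected) (hp0 : 0 < p) (hp1 : p < 1)
    (hpN : ∀ k ∈ Finset.Icc 1 N, p ≠ (k : ℝ) / (N : ℝ))
    (hα : ∀ i, 0 ≤ α i) (hα0 : Tendsto α atTop (𝓝 0))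
    (hαdiv : Tendsto (fun n => ∑ i ∈ Finset.range n, α i) atTop atTop)
    (hη : ∀ i, 0 < η i) (hη0 : Tendsto η atTop (𝓝 0))
    (hηdiv : Tendsto (fun n => ∑ i ∈ Finset.range n, η i) atTop atTop)
    (hαη : Tendsto (fun i => α i / η i) atTop (𝓝 0))
    {w h : ℕ → EuclideanSpace ℝ (Fin N)} (hw : IsPath G x p α η w h)
    (hh : Tendsto h atTop (𝓝 0)) :
    Tendsto (fun i => ‖w i - quantile x p • onesVec N‖) atTop (𝓝 0) := by
  obtain ⟨lam, hlam, hcoer⟩ := exists_lapCLM_coercive G hG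
  obtain ⟨δ, hδ0, hδ⟩ := exists_le_abs_meanCLM_innovationVec x hp0 hpN
  have hq : Tendsto (fun i => centerCLM N (w i - h i)) atTop (𝓝 0) :=
    consensus_tendsto_zero (lapCLM G) (centerCLM N) (lapCLM_centerCLM G) (centerCLM_lapCLM G)
      hlam hcoer hα hη hη0 hηdiv hαη (fun i => norm_innovationVec_le x hp0 hp1 (w i)) hh
      hw.sub_succ
  have he : Tendsto (fun i => ‖centerCLM N (w i - h i)‖ + ‖h i‖) atTop (𝓝 0) := by
    simpa using hq.norm.add hh.norm
  have hc : Tendsto (fun i => |meanCLM N (w i - h i) - quantile x p|) atTop (𝓝 0) := by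
    rw [tendsto_order]
    refine ⟨fun b hb => Eventually.of_forall fun i => hb.trans_le (abs_nonneg _), fun b hb => ?_⟩
    have hev : ∀ᶠ i in atTop, |meanCLM N (w i - h i) - quantile x p| ≤ b / 2 := by
      refine eventually_le_of_le_max_sub (b := fun i => α i * δ)
        (fun i => mul_nonneg (hα i) hδ0.le) ?_ ?_
      · simp_rw [← Finset.sum_mul]
        exact hαdiv.atTop_mul_const hδ0
      · have hea : Tendsto (fun i => ‖centerCLM N (w i - h i)‖ + ‖h i‖ + α i) atTop (𝓝 0) := by
          simpa using he.add hα0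
        filter_upwards [hea.eventually_le_const (half_pos hb)] with i hi
        exact (hw.abs_mean_succ_le hp0 hp1 hδ hα i).trans (max_le_max le_rfl hi)
    filter_upwards [hev] with i hi
    linarith
  refine squeeze_zero (fun i => norm_nonneg _)
    (fun i => norm_sub_smul_onesVec_le (quantile x p) (w i) (h i)) ?_
  simpa using (hc.mul_const ‖onesVec N‖).add he

/-- The distance to the quantile is bounded linearly by the size of the accumulated noise. -/
theorem exists_isPath_bound [NeZero N] (hG : G.Connected) (hp0 : 0 < p) (hp1 : p < 1)
    (hpN : ∀ k ∈ Finset.Icc 1 N, p ≠ (k : ℝ) / (N : ℝ))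
    (hα : ∀ i, 0 ≤ α i) (hα0 : Tendsto α atTop (𝓝 0))
    (hη : ∀ i, 0 < η i) (hη0 : Tendsto η atTop (𝓝 0))
    (hαη : Tendsto (fun i => α i / η i) atTop (𝓝 0)) (v₀ : EuclideanSpace ℝ (Fin N)) :
    ∃ C : ℝ, ∀ (w h : ℕ → EuclideanSpace ℝ (Fin N)) (B : ℝ), IsPath G x p α η w h →
      w 0 = v₀ → h 0 = 0 → (∀ i, ‖h i‖ ≤ B) →
      ∀ i, ‖w i - quantile x p • onesVec N‖ ≤ C * (1 + B) := by
  obtain ⟨lam, hlam, hcoer⟩ := exists_lapCLM_coercive G hG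
  obtain ⟨δ, hδ0, hδ⟩ := exists_le_abs_meanCLM_innovationVec x hp0 hpN
  obtain ⟨A, hA⟩ := hα0.bddAbove_range
  have hA' : ∀ i, α i ≤ A := fun i => hA ⟨i, rfl⟩
  have hA0 : 0 ≤ A := (hα 0).trans (hA' 0)
  obtain ⟨C₁, hC₁, hq⟩ := consensus_bounded (lapCLM G) (centerCLM N) (lapCLM_centerCLM G)
    (centerCLM_lapCLM G) hlam hcoer hα hη hη0 hαη (Real.sqrt_nonneg N) (norm_nonneg v₀)
  set θ := quantile x p
  -- Large enough for the initial distance and for the level `C₁ (1 + B) + B + A`, below which the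
  -- average is not controlled by decrease.
  let K := |meanCLM N v₀ - θ| + C₁ + 1 + A
  refine ⟨K * ‖onesVec N‖ + (C₁ + 1), fun w h B hw hw0 hh0 hh i => ?_⟩
  have hB : 0 ≤ B := (norm_nonneg _).trans (hh 0)
  have hqi : ∀ i, ‖centerCLM N (w i - h i)‖ ≤ C₁ * (1 + B) :=
    hq (fun i => w i - h i) (fun i => innovationVec x p (w i)) h B (by simp [hw0, hh0])
      (fun i => norm_innovationVec_le x hp0 hp1 (w i)) hh hw.sub_succ
  have ha : 0 ≤ |meanCLM N v₀ - θ| := abs_nonneg _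
  have hc : ∀ i, |meanCLM N (w i - h i) - θ| ≤ K * (1 + B) := by
    intro i
    induction i with
    | zero =>
      rw [hw0, hh0, sub_zero]
      simp only [K]
      nlinarith [mul_nonneg ha hB, mul_nonneg hC₁ hB, mul_nonneg hA0 hB]
    | succ i ih =>
      refine (hw.abs_mean_succ_le hp0 hp1 hδ hα i).trans (max_le ?_ ?_)
      · linarith [mul_nonneg (hα i) hδ0.le]
      · simp only [K]
        nlinarith [mul_nonneg ha hB, mul_nonneg hC₁ hB, mul_nonneg hA0 hB, hqi i, hh i, hA' i]
  refine (norm_sub_smul_onesVec_le θ (w i) (h i)).trans ?_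
  have := mul_le_mul_of_nonneg_right (hc i) (norm_nonneg (onesVec N))
  nlinarith [hqi i, hh i]

end Pathwise

/-! ### Polynomial step sizes. -/

section StepSize

theorem stepSize_pos {a : ℝ} (ha : 0 < a) (τ : ℝ) (i : ℕ) : 0 < stepSize a τ i := by
  unfold stepSize
  positivity

theorem tendsto_stepSize_zero (a : ℝ) {τ : ℝ} (hτ : 0 < τ) :
    Tendsto (stepSize a τ) atTop (𝓝 0) := by
  have h : Tendsto (fun i : ℕ => (i : ℝ) + 1) atTop atTop :=
    tendsto_natCast_atTop_atTop.atTop_add tendsto_const_nhds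
  exact ((tendsto_rpow_atTop hτ).comp h).const_div_atTop a

theorem summable_stepSize_iff {a : ℝ} (ha : a ≠ 0) (τ : ℝ) :
    Summable (stepSize a τ) ↔ 1 < τ := by
  have h : stepSize a τ = fun i : ℕ => a * (1 / ((i + 1 : ℕ) : ℝ) ^ τ) := by
    ext i
    simp [stepSize, div_eq_mul_inv]
  rw [h, summable_mul_left_iff ha,
    summable_nat_add_iff (f := fun i : ℕ => 1 / (i : ℝ) ^ τ) 1, Real.summable_one_div_nat_rpow]

theorem tendsto_sum_stepSize_atTop {a τ : ℝ} (ha : 0 < a) (hτ : τ ≤ 1) :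
    Tendsto (fun n => ∑ i ∈ Finset.range n, stepSize a τ i) atTop atTop :=
  (not_summable_iff_tendsto_nat_atTop_of_nonneg fun i => (stepSize_pos ha τ i).le).1
    (by rw [summable_stepSize_iff ha.ne']; exact hτ.not_gt)

theorem summable_stepSize_sq {a τ : ℝ} (ha : a ≠ 0) (hτ : 1 / 2 < τ) :
    Summable fun i => stepSize a τ i ^ 2 := by
  have h : (fun i => stepSize a τ i ^ 2) = stepSize (a ^ 2) (τ * 2) := by
    ext i
    rw [stepSize, stepSize, div_pow, Real.rpow_mul (by positivity), Real.rpow_two]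
  rw [h, summable_stepSize_iff (pow_ne_zero 2 ha)]
  linarith

theorem stepSize_div_stepSize (a b τ σ : ℝ) (i : ℕ) :
    stepSize a τ i / stepSize b σ i = stepSize (a / b) (τ - σ) i := by
  have : (0 : ℝ) < (i : ℝ) + 1 := by positivity
  rw [stepSize, stepSize, stepSize, Real.rpow_sub this]
  field_simp

end StepSize

/-! ### Accumulated link noise. -/

section Noise

variable {N : ℕ} {Ω : Type*} (G : SimpleGraph (Fin N)) [DecidableRel G.Adj] (η : ℕ → ℝ)
  (ξ : Fin N → Fin N → ℕ → Ω → ℝ)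

/-- The sum of all the weighted link noise received by the nodes before time `i`. -/
noncomputable def noiseSum (s : Ω) (i : ℕ) : EuclideanSpace ℝ (Fin N) :=
  WithLp.toLp 2 fun n => ∑ l ∈ G.neighborFinset n, ∑ j ∈ Finset.range i, η j * ξ n l j s

theorem noiseSum_zero (s : Ω) : noiseSum G η ξ s 0 = 0 := by
  ext n
  simp [noiseSum]

theorem noiseSum_succ_sub (s : Ω) (i : ℕ) :
    noiseSum G η ξ s (i + 1) - noiseSum G η ξ s i =
      -(η i • WithLp.toLp 2 (noiseVector G fun n l => ξ n l i s)) := by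
  ext n
  simp [noiseSum, noiseVector, Finset.sum_range_succ, Finset.sum_add_distrib, Finset.mul_sum]

/-- Only increments of the noise enter, so `c` is free: `0` makes `h` start at zero, and the limit
of the noise makes `h` vanish at infinity. -/
theorem isPath_state (x : Fin N → ℝ) (p : ℝ) (α : ℕ → ℝ) (s : Ω)
    (c : EuclideanSpace ℝ (Fin N)) :
    IsPath G x p α η (fun i => WithLp.toLp 2 (state G x p α η ξ s i))
      (fun i => noiseSum G η ξ s i - c) := by
  intro i
  rw [sub_sub_sub_cancel_right, noiseSum_succ_sub, ← sub_eq_add_neg]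
  ext n
  simp [state, lapCLM, innovationVec, Matrix.sub_mulVec, Matrix.smul_mulVec, Matrix.mulVec_sub,
    Matrix.mulVec_smul]
  ring

theorem norm_noiseSum_sq_le (s : Ω) (i : ℕ) :
    ‖noiseSum G η ξ s i‖ ^ 2 ≤ ∑ n, ((G.neighborFinset n).card : ℝ) *
      ∑ l ∈ G.neighborFinset n, (∑ j ∈ Finset.range i, η j * ξ n l j s) ^ 2 := by
  rw [EuclideanSpace.norm_sq_eq]
  gcongr with n
  rw [Real.norm_eq_abs, sq_abs]
  change (∑ l ∈ G.neighborFinset n, ∑ j ∈ Finset.range i, η j * ξ n l j s) ^ 2 ≤ _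
  exact sq_sum_le_card_mul_sum_sq

variable {G η ξ}

theorem exists_tendsto_noiseSum {s : Ω}
    (h : ∀ n l, G.Adj n l → ∃ c, Tendsto (fun i => ∑ j ∈ Finset.range i, η j * ξ n l j s)
      atTop (𝓝 c)) : ∃ c, Tendsto (noiseSum G η ξ s) atTop (𝓝 c) := by
  choose! c hc using h
  refine ⟨WithLp.toLp 2 fun n => ∑ l ∈ G.neighborFinset n, c n l, ?_⟩
  refine ((PiLp.continuous_toLp 2 _).tendsto _).comp (tendsto_pi_nhds.2 fun n => ?_)
  exact tendsto_finsetSum _ fun l hl => hc n l ((G.mem_neighborFinset n l).1 hl)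

variable [MeasurableSpace Ω]

theorem measurable_state (hmeas : ∀ n l, G.Adj n l → ∀ i, Measurable (ξ n l i)) (x : Fin N → ℝ)
    (p : ℝ) (α : ℕ → ℝ) (i : ℕ) : Measurable fun s => state G x p α η ξ s i := by
  induction i with
  | zero => exact measurable_const
  | succ i ih =>
    have hi : ∀ n, Measurable fun s => state G x p α η ξ s i n := measurable_pi_iff.1 ih
    refine measurable_pi_iff.2 fun n => ?_
    simp only [state, Pi.sub_apply, Pi.smul_apply, Matrix.mulVec, dotProduct, innovation,
      noiseVector, smul_eq_mul]
    refine (Finset.measurable_sum _ fun m _ => ?_).sub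
      ((Finset.measurable_sum _ fun l hl => ?_).neg.const_mul _)
    · exact ((hi m).sub (((measurable_unitStep.comp ((hi m).sub_const _)).sub_const p).const_mul
        _)).const_mul _
    · exact hmeas n l ((G.mem_neighborFinset n l).1 hl) i

theorem measurable_sqError (θ : ℝ) : Measurable fun w : Fin N → ℝ => sqError w θ := by
  unfold sqError
  have : Continuous fun w : Fin N → ℝ =>
      ‖(WithLp.toLp 2 (w - θ • (1 : Fin N → ℝ)) : EuclideanSpace ℝ (Fin N))‖ ^ 2 := by fun_prop
  exact this.measurable

end Noise

theorem memLp_of_noiseVarianceSup_lt_top {N : ℕ} {Ω : Type*} [MeasurableSpace Ω] {P : Measure Ω}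
    {G : SimpleGraph (Fin N)} {ξ : Fin N → Fin N → ℕ → Ω → ℝ}
    (hmeas : ∀ n l, G.Adj n l → ∀ i, Measurable (ξ n l i)) (hvar : noiseVarianceSup P G ξ < ⊤)
    {n l : Fin N} (h : G.Adj n l) (i : ℕ) : MemLp (ξ n l i) 2 P := by
  rw [memLp_two_iff_integrable_sq (hmeas n l h i).aestronglyMeasurable]
  refine ⟨((hmeas n l h i).pow_const 2).aestronglyMeasurable, ?_⟩
  rw [hasFiniteIntegral_iff_ofReal (ae_of_all _ fun s => sq_nonneg _)]
  refine lt_of_le_of_lt ?_ hvar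
  exact le_iSup_of_le n (le_iSup_of_le l (le_iSup_of_le h (le_iSup_of_le i le_rfl)))

/-- The two properties of the weighted noise on a single link that enter the convergence proof. -/
theorem link_noise {Ω : Type*} [MeasurableSpace Ω] {P : Measure Ω} [IsFiniteMeasure P]
    {η : ℕ → ℝ} (hη : Summable fun i => η i ^ 2) {ζ : ℕ → Ω → ℝ} (hmeas : ∀ i, Measurable (ζ i))
    (hindep : iIndepFun ζ P) (hident : ∀ i j, IdentDistrib (ζ i) (ζ j) P P)
    (hmean : ∀ i, ∫ s, ζ i s ∂P = 0) (hL : ∀ i, MemLp (ζ i) 2 P) :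
    (∀ᵐ s ∂P, ∃ c, Tendsto (fun n => ∑ i ∈ Finset.range n, η i * ζ i s) atTop (𝓝 c)) ∧
    ∃ g : Ω → ℝ, Integrable g P ∧
      ∀ᵐ s ∂P, ∀ n, (∑ i ∈ Finset.range n, η i * ζ i s) ^ 2 ≤ g s := by
  have h1 : ∀ i, Measurable fun s => η i * ζ i s := fun i => (hmeas i).const_mul _
  have h2 : iIndepFun (fun i s => η i * ζ i s) P :=
    hindep.comp (fun i t => η i * t) fun i => measurable_const_mul _
  have h3 : ∀ i, MemLp (fun s => η i * ζ i s) 2 P := fun i => (hL i).const_mul _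
  have h4 : ∀ i, ∫ s, η i * ζ i s ∂P = 0 := fun i => by rw [integral_const_mul, hmean, mul_zero]
  have h5 : Summable fun i => ∫ s, (η i * ζ i s) ^ 2 ∂P := by
    refine (hη.mul_right (∫ s, ζ 0 s ^ 2 ∂P)).congr fun i => ?_
    simp_rw [mul_pow]
    rw [integral_const_mul]
    congr 1
    exact ((hident 0 i).comp (measurable_id.pow_const 2)).integral_eq
  exact ⟨ae_exists_tendsto_sum h1 h2 h3 h4 h5, exists_integrable_sum_sq_le h1 h2 h3 h4 h5⟩

end DistQuantile

/-! ### Dominated convergence. -/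

theorem theorem2 {N : ℕ} {Ω : Type*} [MeasurableSpace Ω] (P : Measure Ω)
    [IsProbabilityMeasure P]
    (G : SimpleGraph (Fin N)) [DecidableRel G.Adj] (hG : G.Connected)
    (x : Fin N → ℝ)
    (p : ℝ) (hp0 : 0 < p) (hp1 : p < 1)
    (hpN : ∀ k ∈ Finset.Icc 1 N, p ≠ (k : ℝ) / (N : ℝ))
    (α₀ η₀ τ₁ τ₂ : ℝ) (hα₀ : 0 < α₀) (hη₀ : 0 < η₀)
    (hτ₁ : τ₁ ≤ 1) (hτ : τ₂ < τ₁) (hτ₂ : 1 / 2 < τ₂) (hτd : τ₁ - τ₂ < 1 / 2)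
    (ξ : Fin N → Fin N → ℕ → Ω → ℝ)
    (hmeas : ∀ n l, G.Adj n l → ∀ i, Measurable (ξ n l i))
    (hindep : ∀ n l, G.Adj n l → iIndepFun (fun i => ξ n l i) P)
    (hident : ∀ n l, G.Adj n l → ∀ i j, IdentDistrib (ξ n l i) (ξ n l j) P P)
    (hmean : ∀ n l, G.Adj n l → ∀ i, ∫ s, ξ n l i s ∂P = 0)
    (hvar : DistQuantile.noiseVarianceSup P G ξ < ⊤) :
    (∀ i : ℕ, Integrable (fun s =>
      DistQuantile.sqError
        (DistQuantile.state G x p (DistQuantile.stepSize α₀ τ₁) (DistQuantile.stepSize η₀ τ₂)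
          ξ s i)
        (DistQuantile.quantile x p)) P) ∧
    Tendsto (fun i : ℕ => ∫ s,
      DistQuantile.sqError
        (DistQuantile.state G x p (DistQuantile.stepSize α₀ τ₁) (DistQuantile.stepSize η₀ τ₂)
          ξ s i)
        (DistQuantile.quantile x p) ∂P) atTop (𝓝 0) 
:= by
  open DistQuantile in
  have hne : Nonempty (Fin N) := hG.nonempty
  have : NeZero N := ⟨(Fin.pos_iff_nonempty.2 hne).ne'⟩
  set α := stepSize α₀ τ₁ with hα_def
  set η := stepSize η₀ τ₂ with hη_def
  set θ := quantile x p
  have hα : ∀ i, 0 ≤ α i := fun i => (stepSize_pos hα₀ τ₁ i).le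
  have hη : ∀ i, 0 < η i := stepSize_pos hη₀ τ₂
  have hα0 : Tendsto α atTop (𝓝 0) := tendsto_stepSize_zero α₀ (by linarith)
  have hη0 : Tendsto η atTop (𝓝 0) := tendsto_stepSize_zero η₀ (by linarith)
  have hαdiv := tendsto_sum_stepSize_atTop hα₀ hτ₁
  have hηdiv := tendsto_sum_stepSize_atTop hη₀ (hτ.le.trans hτ₁)
  have hαη : Tendsto (fun i => α i / η i) atTop (𝓝 0) := by
    simp_rw [hα_def, hη_def, stepSize_div_stepSize]
    exact tendsto_stepSize_zero _ (sub_pos.2 hτ)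
  have hlink := fun n l (h : G.Adj n l) =>
    link_noise (summable_stepSize_sq hη₀.ne' hτ₂) (hmeas n l h) (hindep n l h) (hident n l h)
      (hmean n l h) (memLp_of_noiseVarianceSup_lt_top hmeas hvar h)
  choose hconv g hg hgle using hlink
  classical
  let g' : Fin N → Fin N → Ω → ℝ := fun n l => if h : G.Adj n l then g n l h else 0
  have hg' : ∀ n l, Integrable (g' n l) P := by
    intro n l
    by_cases h : G.Adj n l
    · simpa [g', h] using hg n l h
    · simp [g', h]
  let H : Ω → ℝ := fun s => ∑ n, ((G.neighborFinset n).card : ℝ) *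
      ∑ l ∈ G.neighborFinset n, g' n l s
  have hH : Integrable H P := integrable_finsetSum _ fun n _ =>
    (integrable_finsetSum _ fun l _ => hg' n l).const_mul _
  have hgood : ∀ᵐ s ∂P, ∀ n l, G.Adj n l →
      (∃ c, Tendsto (fun i => ∑ j ∈ Finset.range i, η j * ξ n l j s) atTop (𝓝 c)) ∧
      ∀ i, (∑ j ∈ Finset.range i, η j * ξ n l j s) ^ 2 ≤ g' n l s := by
    rw [ae_all_iff]; intro n
    rw [ae_all_iff]; intro l
    by_cases h : G.Adj n l
    · filter_upwards [hconv n l h, hgle n l h] with s h1 h2 _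
      refine ⟨h1, ?_⟩
      simpa [g', h] using h2
    · exact ae_of_all _ fun s h' => absurd h' h
  have hsq : ∀ s i, sqError (state G x p α η ξ s i) θ =
      ‖(WithLp.toLp 2 (state G x p α η ξ s i) : EuclideanSpace ℝ (Fin N))
        - θ • onesVec N‖ ^ 2 := fun s i => rfl
  obtain ⟨C, hC⟩ := exists_isPath_bound (x := x) hG hp0 hp1 hpN hα hα0 hη hη0 hαη (WithLp.toLp 2 x)
  have hbound : ∀ᵐ s ∂P, ∀ i, ‖sqError (state G x p α η ξ s i) θ‖ ≤ C ^ 2 * (2 * (1 + H s)) := by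
    filter_upwards [hgood] with s hs i
    have hNH : ∀ i, ‖noiseSum G η ξ s i‖ ^ 2 ≤ H s := fun i =>
      (norm_noiseSum_sq_le G η ξ s i).trans (by
        simp only [H]
        gcongr with n _ l hl
        exact (hs n l ((G.mem_neighborFinset n l).1 hl)).2 i)
    have hH0 : 0 ≤ H s := (sq_nonneg _).trans (hNH 0)
    have hpath := isPath_state G η ξ x p α s 0
    have h1 := hC _ _ (√(H s)) hpath rfl (by simp [noiseSum_zero])
      (fun i => by simpa using Real.le_sqrt_of_sq_le (hNH i)) i
    rw [hsq, Real.norm_of_nonneg (sq_nonneg _)]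
    refine (pow_le_pow_left₀ (norm_nonneg _) h1 2).trans ?_
    rw [mul_pow]
    gcongr
    -- `(1 + √H)² ≤ 2 (1 + H)`.
    nlinarith [Real.sq_sqrt hH0, sq_nonneg (√(H s) - 1)]
  have hmeasE : ∀ i, AEStronglyMeasurable (fun s => sqError (state G x p α η ξ s i) θ) P :=
    fun i => ((measurable_sqError θ).comp (measurable_state hmeas x p α i)).aestronglyMeasurable
  have hdom : Integrable (fun s => C ^ 2 * (2 * (1 + H s))) P :=
    (((integrable_const 1).add hH).const_mul 2).const_mul _
  refine ⟨fun i => hdom.mono' (hmeasE i) (hbound.mono fun s hs => hs i), ?_⟩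
  rw [← integral_zero Ω ℝ (μ := P)]
  refine tendsto_integral_of_dominated_convergence _ hmeasE hdom
    (fun i => hbound.mono fun s hs => hs i) ?_
  filter_upwards [hgood] with s hs
  obtain ⟨c, hc⟩ := exists_tendsto_noiseSum fun n l h => (hs n l h).1
  have := ((isPath_state G η ξ x p α s c).tendsto hG hp0 hp1 hpN hα hα0 hαdiv hη hη0 hηdiv hαη
    (by simpa using hc.sub_const c)).pow 2
  simpa [hsq] using this
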